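/- A $\{0,1\}$-lattice is a lattice with least element $0$ and greatest element $1$, both regarded as constants, such that $0\neq 1$; embeddings of $\{0,1\}$-lattices are injective lattice homomorphisms preserving $0$ and $1$. Let $\mathscr K$ be the class of all finite lattices (including the empty one) or the class of all finite $\{0,1\}$-lattices. A countable lattice (respectively, $\{0,1\}$-lattice) $M$ is a Fraïssé structure for $\mathscr K$ if (U1) for all $A,B\in\mathscr K$ and all embeddings $f:A\to B$, $g:A\to M$ there is an embedding $h:B\to M$ with $h\circ f=g$; (U2) every member of $\mathscr K$ embeds into $M$; and (U3) every finite substructure of $M$ belongs to $\mathscr K$. A Fraïssé limit of $\mathscr K$ is a Fraïssé structure for $\mathscr K$ that is locally finite, i.e. all of whose finitely generated substructures are finite. Proposition. The class of finite lattices has a Fraïssé limit $L^*$, and the class of finite $\{0,1\}$-lattices has a Fraïssé limit $K^*$. For every Fraïssé limit $L^*$ of the finite lattices and all $a<b$ in $L^*$, the interval $[a,b]=\{x\in L^*: a\le x\le b\}$, viewed as a $\{0,1\}$-lattice with $0=a$ and $1=b$, is a Fraïssé structure for the class of finite $\{0,1\}$-lattices. Moreover, for every Fraïssé limit $K^*$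 of the finite $\{0,1\}$-lattices, $[a,b]$ is isomorphic to $K^*$, and $[a,b]$ is isomorphic to $[c,d]$ for all $c<d$ in $K^*$. -/

import Mathlib

/-- Local finiteness: the sublattice generated by a finite subset is finite. -/
def LocallyFiniteLattice (L : Type*) [Lattice L] : Prop :=
  ∀ s : Set L, s.Finite → (latticeClosure s).Finite

/-- Local finiteness of a bounded lattice in the signature with operations `⊔`, `⊓` and constants
`⊥`, `⊤`: the `{0,1}`-sublattice generated by a finite subset is finite. -/
def LocallyFiniteBoundedLattice (K : Type*) [Lattice K] [BoundedOrder K] : Prop :=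
  ∀ s : Set K, s.Finite → (latticeClosure (s ∪ {⊥, ⊤})).Finite

/-- `L` is a Fraïssé structure for the class of finite lattices (the empty lattice is allowed).
Finite lattices are taken in `Type`, which up to isomorphism is all of them. That finite
sublattices of `L` belong to the class is automatic for a lattice `L`. -/
structure IsFraisseStructureFinLat (L : Type*) [Lattice L] : Prop where
  countable : Countable L
  /-- Every embedding of a finite lattice `A` in `L` extends to any finite lattice `B ≥ A`. -/
  ultrahomogeneous : ∀ (A B : Type) [Lattice A] [Lattice B] [Finite A] [Finite B]
    (f : LatticeHom A B) (g : LatticeHom A L), Function.Injective f → Function.Injective g →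
    ∃ h : LatticeHom B L, Function.Injective h ∧ ∀ x, h (f x) = g x
  /-- Every finite lattice embeds in `L`. -/
  universal : ∀ (B : Type) [Lattice B] [Finite B],
    ∃ h : LatticeHom B L, Function.Injective h

/-- `K` is a Fraïssé structure for the class of finite `{0,1}`-lattices. A `{0,1}`-lattice is a
bounded lattice with `0 ≠ 1`, and embeddings preserve `0` and `1`. -/
structure IsFraisseStructureFinBddLat (K : Type*) [Lattice K] [BoundedOrder K] : Prop where
  countable : Countable K
  /-- Every embedding of a finite `{0,1}`-lattice `A` in `K` extends to any finite
  `{0,1}`-lattice `B ≥ A`. -/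
  ultrahomogeneous : ∀ (A B : Type) [Lattice A] [BoundedOrder A] [Nontrivial A] [Finite A]
    [Lattice B] [BoundedOrder B] [Nontrivial B] [Finite B]
    (f : BoundedLatticeHom A B) (g : BoundedLatticeHom A K),
    Function.Injective f → Function.Injective g →
    ∃ h : BoundedLatticeHom B K, Function.Injective h ∧ ∀ x, h (f x) = g x
  /-- Every finite `{0,1}`-lattice embeds in `K`. -/
  universal : ∀ (B : Type) [Lattice B] [BoundedOrder B] [Nontrivial B] [Finite B],
    ∃ h : BoundedLatticeHom B K, Function.Injective h
  /-- Every finite `{0,1}`-sublattice of `K` belongs to the class, that is, has `0 ≠ 1`. -/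
  bot_ne_top : (⊥ : K) ≠ ⊤

/-- `L` is (isomorphic to) the Fraïssé limit of the finite lattices, the typical lattice. -/
structure IsFraisseLimitFinLat (L : Type*) [Lattice L] : Prop where
  isFraisse : IsFraisseStructureFinLat L
  locallyFinite : LocallyFiniteLattice L

/-- `K` is (isomorphic to) the Fraïssé limit of the finite `{0,1}`-lattices, the typical
`{0,1}`-lattice. -/
structure IsFraisseLimitFinBddLat (K : Type*) [Lattice K] [BoundedOrder K] : Prop where
  isFraisse : IsFraisseStructureFinBddLat K
  locallyFinite : LocallyFiniteBoundedLattice K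

/-- The interval `[a, b]`, viewed as a `{0,1}`-lattice with `0 = a` and `1 = b`. -/
abbrev intervalBoundedOrder {L : Type*} [Lattice L] {a b : L} (h : a < b) :
    BoundedOrder (Set.Icc a b) :=
  haveI : Fact (a ≤ b) := ⟨h.le⟩
  inferInstance

/-! Finite lattices amalgamate: for embeddings of `A` in `B` and `C`, the pairs of ideals with the
same trace on `A` are closed under intersection, hence form a finite complete lattice, in which `B`
and `C` embed by principal pairs that agree on `A`. Up to isomorphism each size bound leaves
finitely many extension problems over a finite lattice, so iterated amalgamation yields a chain of
finite lattices solving larger and larger problems; its direct limit is `L*`.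

An embedding into `L*` that sends `0` to `a` and `1` to `b` has its range in `[a, b]`, so the
extension property and local finiteness pass from `L*` to its intervals. In particular `K*` exists,
as an interval of `L*`. A back-and-forth argument shows that `K*` is unique up to isomorphism.
Finally, an isomorphism of `K*` with `[a, b]` turns intervals of `K*` into intervals of `L*`, so
they are copies of `K*` too. -/

/-! ### Amalgamation of finite lattices -/

/-- The elements of the amalgam of `B` and `C` over `A`: pairs of (possibly empty) ideals of `B` and
`C` with the same trace on `A`. -/
@[ext]
structure LatticeAmalgam {A B C : Type*} [Lattice A] [Lattice B] [Lattice C]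
    (f : LatticeHom A B) (g : LatticeHom A C) where
  /-- The ideal of the left factor. -/
  left : Set B
  /-- The ideal of the right factor. -/
  right : Set C
  isLowerSet_left : IsLowerSet left
  isLowerSet_right : IsLowerSet right
  supClosed_left : SupClosed left
  supClosed_right : SupClosed right
  mem_iff : ∀ a, f a ∈ left ↔ g a ∈ right

namespace LatticeAmalgam

variable {A B C : Type*} [Lattice A] [Lattice B] [Lattice C]
  {f : LatticeHom A B} {g : LatticeHom A C}

theorem toProd_injective :
    Function.Injective fun I : LatticeAmalgam f g ↦ (I.left, I.right) := fun _ _ h ↦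
  LatticeAmalgam.ext (congrArg Prod.fst h) (congrArg Prod.snd h)

instance : PartialOrder (LatticeAmalgam f g) :=
  PartialOrder.lift (fun I ↦ (I.left, I.right)) toProd_injective

theorem le_def {I J : LatticeAmalgam f g} : I ≤ J ↔ I.left ⊆ J.left ∧ I.right ⊆ J.right :=
  Iff.rfl

instance [Finite B] [Finite C] : Finite (LatticeAmalgam f g) :=
  Finite.of_injective _ toProd_injective

instance : InfSet (LatticeAmalgam f g) where
  sInf S :=
    { left := ⋂ I ∈ S, I.left
      right := ⋂ I ∈ S, I.right
      isLowerSet_left := isLowerSet_iInter₂ fun I _ ↦ I.isLowerSet_left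
      isLowerSet_right := isLowerSet_iInter₂ fun I _ ↦ I.isLowerSet_right
      supClosed_left := supClosed_iInter fun I ↦ supClosed_iInter fun _ ↦ I.supClosed_left
      supClosed_right := supClosed_iInter fun I ↦ supClosed_iInter fun _ ↦ I.supClosed_right
      mem_iff := fun a ↦ by simp only [Set.mem_iInter, mem_iff] }

instance : CompleteLattice (LatticeAmalgam f g) :=
  completeLatticeOfInf _ fun _ ↦
    ⟨fun _ hI ↦ le_def.2 ⟨Set.biInter_subset_of_mem hI, Set.biInter_subset_of_mem hI⟩,
      fun _ hJ ↦ le_def.2 ⟨Set.subset_iInter₂ fun _ hI ↦ (hJ hI).1,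
        Set.subset_iInter₂ fun _ hI ↦ (hJ hI).2⟩⟩

variable (f) in
/-- The principal ideal of the amalgam generated by an element of the left factor. -/
def principalLeft (hg : Function.Injective g) (b : B) : LatticeAmalgam f g where
  left := Set.Iic b
  -- The ideal of `C` that the trace condition forces. It is empty when no element of `A` lies below
  -- `b`, which is why empty ideals are admitted.
  right := {c | ∃ a, c ≤ g a ∧ f a ≤ b}
  isLowerSet_left := isLowerSet_Iic b
  isLowerSet_right := fun _ _ hcd ⟨a, ha, hb⟩ ↦ ⟨a, hcd.trans ha, hb⟩
  supClosed_left := fun _ hx _ hy ↦ sup_le hx hy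
  supClosed_right := fun _ ⟨a, ha, hb⟩ _ ⟨a', ha', hb'⟩ ↦
    ⟨a ⊔ a', by rw [map_sup]; exact sup_le_sup ha ha', by rw [map_sup]; exact sup_le hb hb'⟩
  mem_iff := fun a ↦ ⟨fun h ↦ ⟨a, le_rfl, h⟩, fun ⟨a', ha, hb⟩ ↦ by
    have h : a ≤ a' := by
      rw [← sup_eq_right] at ha ⊢
      exact hg (by rw [map_sup, ha])
    exact (OrderHomClass.mono f h).trans hb⟩

/-- The principal pair is the least pair whose left ideal contains `b`. Preservation of joins and
agreement of the two embeddings on `A` follow by comparing upper bounds. -/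
theorem principalLeft_le_iff (hg : Function.Injective g) {b : B} {I : LatticeAmalgam f g} :
    principalLeft f hg b ≤ I ↔ b ∈ I.left :=
  ⟨fun h ↦ h.1 (Set.mem_Iic.2 le_rfl), fun h ↦ ⟨fun _ hx ↦ I.isLowerSet_left hx h,
    fun _ ⟨a, ha, hb⟩ ↦ I.isLowerSet_right ha ((I.mem_iff a).1 (I.isLowerSet_left hb h))⟩⟩

variable (f) in
/-- The embedding of the left factor in the amalgam. -/
def inl (hg : Function.Injective g) : LatticeHom B (LatticeAmalgam f g) where
  toFun := principalLeft f hg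
  map_sup' b b' := eq_of_forall_ge_iff fun I ↦ by
    simp only [sup_le_iff, principalLeft_le_iff]
    exact ⟨fun h ↦ ⟨I.isLowerSet_left le_sup_left h, I.isLowerSet_left le_sup_right h⟩,
      fun h ↦ I.supClosed_left h.1 h.2⟩
  map_inf' b b' := by
    refine le_antisymm (le_inf ?_ ?_) ⟨fun x hx ↦ ?_, fun x hx ↦ ?_⟩
    · exact (principalLeft_le_iff hg).2 (Set.mem_Iic.2 inf_le_left)
    · exact (principalLeft_le_iff hg).2 (Set.mem_Iic.2 inf_le_right)
    · exact le_inf ((inf_le_left (a := principalLeft f hg b) (b := principalLeft f hg b')).1 hx)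
        ((inf_le_right (a := principalLeft f hg b) (b := principalLeft f hg b')).1 hx)
    · obtain ⟨a, ha, hb⟩ :=
        (inf_le_left (a := principalLeft f hg b) (b := principalLeft f hg b')).2 hx
      obtain ⟨a', ha', hb'⟩ :=
        (inf_le_right (a := principalLeft f hg b) (b := principalLeft f hg b')).2 hx
      exact ⟨a ⊓ a', by rw [map_inf]; exact le_inf ha ha', by rw [map_inf]; exact inf_le_inf hb hb'⟩

theorem inl_le_iff (hg : Function.Injective g) {b : B} {I : LatticeAmalgam f g} :
    inl f hg b ≤ I ↔ b ∈ I.left :=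
  principalLeft_le_iff hg

theorem inl_injective (hg : Function.Injective g) : Function.Injective (inl f hg) := fun _ _ h ↦
  le_antisymm ((inl_le_iff hg).1 h.le) ((inl_le_iff hg).1 h.ge)

variable (f g) in
/-- The symmetry of the amalgam. -/
def swap : LatticeAmalgam g f ≃o LatticeAmalgam f g where
  toFun I := ⟨I.right, I.left, I.isLowerSet_right, I.isLowerSet_left, I.supClosed_right,
    I.supClosed_left, fun a ↦ (I.mem_iff a).symm⟩
  invFun I := ⟨I.right, I.left, I.isLowerSet_right, I.isLowerSet_left, I.supClosed_right,
    I.supClosed_left, fun a ↦ (I.mem_iff a).symm⟩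
  left_inv _ := rfl
  right_inv _ := rfl
  map_rel_iff' := and_comm

theorem inl_apply_eq_swap_inl (hf : Function.Injective f) (hg : Function.Injective g) (a : A) :
    inl f hg (f a) = swap f g (inl g hf (g a)) :=
  eq_of_forall_ge_iff fun I ↦ by
    rw [inl_le_iff, ← (swap f g).le_symm_apply, inl_le_iff]
    exact I.mem_iff a

end LatticeAmalgam

/-- Finite lattices have the amalgamation property. -/
theorem exists_amalgam {A B C : Type} [Lattice A] [Lattice B] [Lattice C] [Finite B] [Finite C]
    (f : LatticeHom A B) (g : LatticeHom A C) (hf : Function.Injective f)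
    (hg : Function.Injective g) :
    ∃ (D : Type) (_ : Lattice D) (_ : Finite D) (i : LatticeHom B D) (j : LatticeHom C D),
      Function.Injective i ∧ Function.Injective j ∧ ∀ a, i (f a) = j (g a) :=
  ⟨LatticeAmalgam f g, inferInstance, inferInstance, LatticeAmalgam.inl f hg,
    (LatticeAmalgam.swap f g : LatticeHom (LatticeAmalgam g f) (LatticeAmalgam f g)).comp
      (LatticeAmalgam.inl g hf),
    LatticeAmalgam.inl_injective hg,
    (LatticeAmalgam.swap f g).injective.comp (LatticeAmalgam.inl_injective hf),
    LatticeAmalgam.inl_apply_eq_swap_inl hf hg⟩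

/-! ### Extension problems and the chain of finite lattices -/

/-- A lattice structure transported along a bijection. -/
theorem Equiv.exists_lattice_orderIso {α β : Type*} [Lattice β] (e : α ≃ β) :
    ∃ _ : Lattice α, Nonempty (α ≃o β) := by
  let : Max α := ⟨fun x y ↦ e.symm (e x ⊔ e y)⟩
  let : Min α := ⟨fun x y ↦ e.symm (e x ⊓ e y)⟩
  let : PartialOrder α := PartialOrder.lift e e.injective
  exact ⟨e.injective.lattice e Iff.rfl Iff.rfl (fun _ _ ↦ e.apply_symm_apply _)
    (fun _ _ ↦ e.apply_symm_apply _), ⟨e, Iff.rfl⟩⟩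

instance Lattice.finite_of_finite (α : Type*) [Finite α] : Finite (Lattice α) :=
  Finite.of_injective (fun (L : Lattice α) (x y : α) ↦ L.le x y) fun _ _ h ↦
    Lattice.ext fun x y ↦ iff_of_eq (congrFun (congrFun h x) y)

/-- A finite lattice, bundled. -/
structure FinLat where
  /-- The underlying type. -/
  carrier : Type
  [lattice : Lattice carrier]
  [finite : Finite carrier]

namespace FinLat

instance : CoeSort FinLat Type := ⟨carrier⟩

attribute [instance] lattice finite

/-- Up to isomorphism there are finitely many lattices with at most `n` elements. -/
theorem exists_finite_representatives (n : ℕ) :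
    ∃ (ι : Type) (_ : Finite ι) (F : ι → FinLat), ∀ A : FinLat, Nat.card A ≤ n →
      ∃ i, Nonempty (F i ≃o A) := by
  refine ⟨Σ k : Fin (n + 1), Lattice (Fin k), inferInstance,
    fun i ↦ @FinLat.mk (Fin i.1) i.2 inferInstance, fun A hA ↦ ?_⟩
  obtain ⟨L, e⟩ := (Finite.equivFin A).symm.exists_lattice_orderIso
  exact ⟨⟨⟨Nat.card A, Nat.lt_succ_of_le hA⟩, L⟩, e⟩

/-- `e : X → Y` solves the extension problem given by `f : A → B` and `g : A → X`. -/
def Solves {A B X Y : FinLat} (f : LatticeHom A B) (g : LatticeHom A X) (e : LatticeHom X Y) :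
    Prop :=
  ∃ h : LatticeHom B Y, Function.Injective h ∧ ∀ x, h (f x) = e (g x)

/-- Amalgamation handles one problem at a time; a solved problem stays solved after composition with
a further embedding. -/
theorem exists_solves_finite {ι : Type*} [Finite ι] (X : FinLat) (A B : ι → FinLat)
    (f : ∀ i, LatticeHom (A i) (B i)) (g : ∀ i, LatticeHom (A i) X)
    (hf : ∀ i, Function.Injective (f i)) (hg : ∀ i, Function.Injective (g i)) :
    ∃ (Y : FinLat) (e : LatticeHom X Y), Function.Injective e ∧ ∀ i, Solves (f i) (g i) e := by
  classical
  have := Fintype.ofFinite ι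
  suffices h : ∀ s : Finset ι, ∃ (Y : FinLat) (e : LatticeHom X Y),
      Function.Injective e ∧ ∀ i ∈ s, Solves (f i) (g i) e by
    simpa using h Finset.univ
  intro s
  induction s using Finset.induction_on with
  | empty => exact ⟨X, LatticeHom.id X, Function.injective_id, by simp⟩
  | insert i s _ ih =>
    obtain ⟨Y, e, he, hs⟩ := ih
    obtain ⟨D, _, _, u, v, hu, hv, huv⟩ :=
      exists_amalgam (f i) (e.comp (g i)) (hf i) (he.comp (hg i))
    refine ⟨⟨D⟩, v.comp e, hv.comp he, fun j hj ↦ ?_⟩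
    obtain rfl | hj := Finset.mem_insert.1 hj
    · exact ⟨u, hu, huv⟩
    · obtain ⟨h, hh, hfg⟩ := hs j hj
      exact ⟨v.comp h, hv.comp hh, fun x ↦ congrArg v (hfg x)⟩

/-- Every finite lattice embeds in a finite lattice solving all its extension problems of size at
most `n`. -/
theorem exists_solves_card_le (n : ℕ) (X : FinLat) :
    ∃ (Y : FinLat) (e : LatticeHom X Y), Function.Injective e ∧
      ∀ (A B : FinLat) (f : LatticeHom A B) (g : LatticeHom A X), Nat.card B ≤ n →
        Function.Injective f → Function.Injective g → Solves f g e := by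
  obtain ⟨ι, _, F, hF⟩ := exists_finite_representatives n
  have hfin (A B : FinLat) : Finite (LatticeHom A B) := DFunLike.finite _
  obtain ⟨Y, e, he, hY⟩ := exists_solves_finite
    (ι := Σ i j : ι, {f : LatticeHom (F i) (F j) // Function.Injective f} ×
      {g : LatticeHom (F i) X // Function.Injective g}) X (fun p ↦ F p.1) (fun p ↦ F p.2.1)
    (fun p ↦ p.2.2.1.1) (fun p ↦ p.2.2.2.1) (fun p ↦ p.2.2.1.2) (fun p ↦ p.2.2.2.2)
  refine ⟨Y, e, he, fun A B f g hB hf hg ↦ ?_⟩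
  obtain ⟨i, ⟨u⟩⟩ := hF A ((Nat.card_le_card_of_injective f hf).trans hB)
  obtain ⟨j, ⟨v⟩⟩ := hF B hB
  obtain ⟨h, hh, hfg⟩ := hY ⟨i, j,
    ⟨(v.symm : LatticeHom B (F j)).comp (f.comp (u : LatticeHom (F i) A)),
      v.symm.injective.comp (hf.comp u.injective)⟩,
    ⟨g.comp (u : LatticeHom (F i) A), hg.comp u.injective⟩⟩
  refine ⟨h.comp (v.symm : LatticeHom B (F j)), hh.comp v.symm.injective, fun x ↦ ?_⟩
  simpa using hfg (u.symm x)

/-- A chain of finite lattices whose `n`-th step solves all extension problems of size at most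
`n`. -/
theorem exists_chain : ∃ (X : ℕ → FinLat) (e : ∀ n, LatticeHom (X n) (X (n + 1))),
    ∀ n, Function.Injective (e n) ∧
      ∀ (A B : FinLat) (f : LatticeHom A B) (g : LatticeHom A (X n)), Nat.card B ≤ n →
        Function.Injective f → Function.Injective g → Solves f g (e n) := by
  choose Y e h using exists_solves_card_le
  exact ⟨fun n ↦ Nat.rec ⟨Unit⟩ Y n, fun n ↦ e n _, fun n ↦ h n _⟩

end FinLat

/-! ### Direct limits of lattices -/

namespace LatticeHom

variable {X : ℕ → Type*} [∀ n, Lattice (X n)]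

/-- The composites of a sequence of lattice homomorphisms. -/
def natLERec (e : ∀ n, LatticeHom (X n) (X (n + 1))) (m n : ℕ) (h : m ≤ n) :
    LatticeHom (X m) (X n) :=
  Nat.leRecOn h (fun {k} φ ↦ (e k).comp φ) (LatticeHom.id _)

theorem natLERec_self (e : ∀ n, LatticeHom (X n) (X (n + 1))) (n : ℕ) (x : X n) :
    natLERec e n n le_rfl x = x := by
  rw [natLERec, Nat.leRecOn_self, id_apply]

theorem natLERec_succ (e : ∀ n, LatticeHom (X n) (X (n + 1))) {m n : ℕ} (h : m ≤ n) (x : X m) :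
    natLERec e m (n + 1) (h.trans n.le_succ) x = e n (natLERec e m n h x) := by
  rw [natLERec, Nat.leRecOn_succ h]
  rfl

theorem natLERec_trans (e : ∀ n, LatticeHom (X n) (X (n + 1))) {l m n : ℕ} (hlm : l ≤ m)
    (hmn : m ≤ n) (x : X l) :
    natLERec e m n hmn (natLERec e l m hlm x) = natLERec e l n (hlm.trans hmn) x := by
  induction n, hmn using Nat.le_induction with
  | base => exact natLERec_self e m _
  | succ n hmn ih => rw [natLERec_succ e hmn, ih, natLERec_succ e (hlm.trans hmn)]

theorem natLERec_injective (e : ∀ n, LatticeHom (X n) (X (n + 1)))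
    (he : ∀ n, Function.Injective (e n)) (m n : ℕ) (h : m ≤ n) :
    Function.Injective (natLERec e m n h) := by
  induction n, h using Nat.le_induction with
  | base => exact fun x y hxy ↦ by simpa only [natLERec_self] using hxy
  | succ n h ih => exact fun x y hxy ↦ ih (he n (by simpa only [natLERec_succ e h] using hxy))

instance natLERec_directedSystem (e : ∀ n, LatticeHom (X n) (X (n + 1))) :
    DirectedSystem X (natLERec e · · ·) where
  map_self _ x := natLERec_self e _ x
  map_map _ _ _ hij hjk x := natLERec_trans e hij hjk x

end LatticeHom

namespace DirectLimit

variable {ι : Type*} [Preorder ι] [IsDirectedOrder ι] {G : ι → Type*} [∀ i, Lattice (G i)]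
  (f : ∀ i j (_ : i ≤ j), LatticeHom (G i) (G j)) [DirectedSystem G (f · · ·)]

/-- The direct limit of a directed system of lattices. -/
noncomputable instance instLattice : Lattice (DirectLimit G f) :=
  letI : Max (DirectLimit G f) :=
    ⟨DirectLimit.map₂ f f f (fun _ x y ↦ x ⊔ y) fun i j h ↦ map_sup (f i j h)⟩
  letI : Min (DirectLimit G f) :=
    ⟨DirectLimit.map₂ f f f (fun _ x y ↦ x ⊓ y) fun i j h ↦ map_inf (f i j h)⟩
  have hsup (i) (x y : G i) : (⟦⟨i, x⟩⟧ ⊔ ⟦⟨i, y⟩⟧ : DirectLimit G f) = ⟦⟨i, x ⊔ y⟩⟧ :=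
    DirectLimit.map₂_def ..
  have hinf (i) (x y : G i) : (⟦⟨i, x⟩⟧ ⊓ ⟦⟨i, y⟩⟧ : DirectLimit G f) = ⟦⟨i, x ⊓ y⟩⟧ :=
    DirectLimit.map₂_def ..
  Lattice.mk'
    (DirectLimit.induction₂ f fun i x y ↦ by simp_rw [hsup, sup_comm])
    (DirectLimit.induction₃ f fun i x y z ↦ by simp_rw [hsup, sup_assoc])
    (DirectLimit.induction₂ f fun i x y ↦ by simp_rw [hinf, inf_comm])
    (DirectLimit.induction₃ f fun i x y z ↦ by simp_rw [hinf, inf_assoc])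
    (DirectLimit.induction₂ f fun i x y ↦ by simp_rw [hinf, hsup, sup_inf_self])
    (DirectLimit.induction₂ f fun i x y ↦ by simp_rw [hsup, hinf, inf_sup_self])

/-- The canonical homomorphism from a member of a directed system to the direct limit. -/
noncomputable def latticeHomOf (i : ι) : LatticeHom (G i) (DirectLimit G f) where
  toFun x := ⟦⟨i, x⟩⟧
  map_sup' x y := (DirectLimit.map₂_def f f f (fun _ x y ↦ x ⊔ y) _ i x y).symm
  map_inf' x y := (DirectLimit.map₂_def f f f (fun _ x y ↦ x ⊓ y) _ i x y).symm

theorem latticeHomOf_injective (hf : ∀ i j h, Function.Injective (f i j h)) (i : ι) :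
    Function.Injective (latticeHomOf f i) :=
  DirectLimit.mk_injective f hf i

theorem latticeHomOf_map (i j : ι) (h : i ≤ j) (x : G i) :
    latticeHomOf f j (f i j h x) = latticeHomOf f i x :=
  DirectLimit.mk_apply i j x h

/-- By directedness, finitely many elements of the limit have representatives at one common stage.
-/
theorem exists_latticeHomOf_eq [Nonempty ι] {α : Type*} [Finite α] (m : α → DirectLimit G f) :
    ∃ i, ∃ x : α → G i, ∀ a, latticeHomOf f i (x a) = m a := by
  choose i x hx using fun a ↦ DirectLimit.exists_eq_mk f (m a)
  obtain ⟨N, hN⟩ := Finite.exists_le i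
  exact ⟨N, fun a ↦ f _ _ (hN a) (x a), fun a ↦ (latticeHomOf_map f _ _ (hN a) _).trans (hx a).symm⟩

/-- A finite set lies in the image of a single stage, which is a finite sublattice. -/
theorem locallyFiniteLattice [Nonempty ι] [∀ i, Finite (G i)] :
    LocallyFiniteLattice (DirectLimit G f) := by
  intro s hs
  have := hs.to_subtype
  obtain ⟨i, x, hx⟩ := exists_latticeHomOf_eq f (Subtype.val : s → DirectLimit G f)
  refine (Set.finite_range (latticeHomOf f i)).subset (latticeClosure_min ?_ ⟨?_, ?_⟩)
  · exact fun a ha ↦ ⟨x ⟨a, ha⟩, hx ⟨a, ha⟩⟩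
  · rintro _ ⟨a, rfl⟩ _ ⟨b, rfl⟩
    exact ⟨a ⊔ b, map_sup _ _ _⟩
  · rintro _ ⟨a, rfl⟩ _ ⟨b, rfl⟩
    exact ⟨a ⊓ b, map_inf _ _ _⟩

end DirectLimit

/-! ### Existence of the limit of the finite lattices -/

/-- A function whose composite with an injective lattice homomorphism is a lattice homomorphism. -/
def LatticeHom.ofInjective {α β γ : Type*} [Lattice α] [Lattice β] [Lattice γ]
    (j : LatticeHom β γ) (hj : Function.Injective j) (φ : LatticeHom α γ) (x : α → β)
    (hx : ∀ a, j (x a) = φ a) : LatticeHom α β where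
  toFun := x
  map_sup' a b := hj (by simp [hx])
  map_inf' a b := hj (by simp [hx])

/-- The class of finite lattices has a Fraïssé limit. -/
theorem exists_isFraisseLimitFinLat : ∃ (L : Type) (_ : Lattice L), IsFraisseLimitFinLat L := by
  obtain ⟨X, e, he⟩ := FinLat.exists_chain
  let f := LatticeHom.natLERec e
  have hinj := DirectLimit.latticeHomOf_injective f
    (LatticeHom.natLERec_injective e fun n ↦ (he n).1)
  have extend (A B : Type) [Lattice A] [Lattice B] [Finite A] [Finite B] (u : LatticeHom A B)
      (g : LatticeHom A (DirectLimit (fun n ↦ (X n : Type)) f)) (hu : Function.Injective u)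
      (hg : Function.Injective g) :
      ∃ h : LatticeHom B (DirectLimit (fun n ↦ (X n : Type)) f),
        Function.Injective h ∧ ∀ x, h (u x) = g x := by
    obtain ⟨i, x, hx⟩ := DirectLimit.exists_latticeHomOf_eq f g
    -- A stage late enough both to contain the image of `g` and to have problems of the size of `B`
    -- solved at the next step.
    let n := max i (Nat.card B)
    let y (a : A) : X n := f i n (le_max_left _ _) (x a)
    have hy (a : A) : DirectLimit.latticeHomOf f n (y a) = g a :=
      (DirectLimit.latticeHomOf_map f _ _ _ _).trans (hx a)
    let g' : LatticeHom A (X n) := LatticeHom.ofInjective _ (hinj n) g y hy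
    have hg' : Function.Injective g' := fun a b hab ↦ hg (by
      rw [← hy a, ← hy b]; exact congrArg _ hab)
    obtain ⟨h, hh, hug⟩ := (he n).2 ⟨A⟩ ⟨B⟩ u g' (le_max_right _ _) hu hg'
    refine ⟨(DirectLimit.latticeHomOf f (n + 1)).comp h, (hinj (n + 1)).comp hh, fun a ↦ ?_⟩
    have hstep : f n (n + 1) n.le_succ (g' a) = e n (g' a) :=
      (LatticeHom.natLERec_succ e le_rfl _).trans (congrArg _ (LatticeHom.natLERec_self e n _))
    rw [LatticeHom.comp_apply, hug, ← hstep, DirectLimit.latticeHomOf_map]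
    exact hy a
  refine ⟨DirectLimit (fun n ↦ (X n : Type)) f, inferInstance, ⟨inferInstance, extend, ?_⟩,
    DirectLimit.locallyFiniteLattice f⟩
  intro B _ _
  -- Since the empty lattice is allowed, universality is extension from it.
  obtain ⟨h, hh, -⟩ := extend Empty B
    ⟨⟨Empty.elim, fun a ↦ a.elim⟩, fun a ↦ a.elim⟩ ⟨⟨Empty.elim, fun a ↦ a.elim⟩, fun a ↦ a.elim⟩
    (fun a ↦ a.elim) (fun a ↦ a.elim)
  exact ⟨h, hh⟩

/-! ### Intervals as `{0,1}`-lattices -/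

/-- The homomorphism from the two-element lattice to a bounded lattice. -/
def BoundedLatticeHom.ofBool (P : Type*) [Lattice P] [BoundedOrder P] :
    BoundedLatticeHom Bool P where
  toFun x := cond x ⊤ ⊥
  map_sup' := by rintro (_ | _) (_ | _) <;> simp
  map_inf' := by rintro (_ | _) (_ | _) <;> simp
  map_top' := rfl
  map_bot' := rfl

theorem BoundedLatticeHom.ofBool_injective {P : Type*} [Lattice P] [BoundedOrder P]
    (h : (⊥ : P) ≠ ⊤) : Function.Injective (BoundedLatticeHom.ofBool P)
  | false, false, _ => rfl
  | true, true, _ => rfl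
  | false, true, hxy => (h hxy).elim
  | true, false, hxy => (h hxy.symm).elim

section Interval

variable {L : Type*} [Lattice L] {a b : L}

/-- The inclusion of an interval. -/
def Set.Icc.latticeHomVal (a b : L) : LatticeHom (Set.Icc a b) L where
  toFun := Subtype.val
  map_sup' _ _ := rfl
  map_inf' _ _ := rfl

/-- Intervals of a Fraïssé structure for the finite lattices are Fraïssé structures for the finite
`{0,1}`-lattices. -/
theorem IsFraisseStructureFinLat.Icc (hL : IsFraisseStructureFinLat L) (hab : a < b) :
    @IsFraisseStructureFinBddLat (Set.Icc a b) _ (intervalBoundedOrder hab) := by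
  let := intervalBoundedOrder hab
  have := hL.countable
  have hne : (⊥ : Set.Icc a b) ≠ ⊤ := fun h ↦ hab.ne (congrArg Subtype.val h)
  have extend (A B : Type) [Lattice A] [BoundedOrder A] [Nontrivial A] [Finite A]
      [Lattice B] [BoundedOrder B] [Nontrivial B] [Finite B]
      (f : BoundedLatticeHom A B) (g : BoundedLatticeHom A (Set.Icc a b))
      (hf : Function.Injective f) (hg : Function.Injective g) :
      ∃ h : BoundedLatticeHom B (Set.Icc a b), Function.Injective h ∧ ∀ x, h (f x) = g x := by
    obtain ⟨h, hh, hfg⟩ := hL.ultrahomogeneous A B f.toLatticeHom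
      ((Set.Icc.latticeHomVal a b).comp g.toLatticeHom) hf (Subtype.val_injective.comp hg)
    have hfg (x : A) : h (f x) = g x := hfg x
    -- The bounds of `B` come from those of `A`, so `h` sends them to `a` and `b`, and monotonicity
    -- confines its range to `[a, b]`.
    have hbot : h ⊥ = a := by rw [← map_bot f, hfg, map_bot]; rfl
    have htop : h ⊤ = b := by rw [← map_top f, hfg, map_top]; rfl
    refine ⟨⟨⟨⟨fun x ↦ ⟨h x, ?_, ?_⟩, fun x y ↦ Subtype.ext (map_sup h x y)⟩,
      fun x y ↦ Subtype.ext (map_inf h x y)⟩, Subtype.ext htop, Subtype.ext hbot⟩, ?_, ?_⟩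
    · rw [← hbot]
      exact OrderHomClass.mono h bot_le
    · rw [← htop]
      exact OrderHomClass.mono h le_top
    · exact fun x y hxy ↦ hh (congrArg Subtype.val hxy)
    · exact fun x ↦ Subtype.ext (hfg x)
  refine ⟨inferInstance, extend, fun B _ _ _ _ ↦ ?_, hne⟩
  -- The two-element lattice embeds in every `{0,1}`-lattice, so universality is extension from it.
  obtain ⟨h, hh, -⟩ := extend Bool B (BoundedLatticeHom.ofBool B) (BoundedLatticeHom.ofBool _)
    (BoundedLatticeHom.ofBool_injective bot_ne_top) (BoundedLatticeHom.ofBool_injective hne)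
  exact ⟨h, hh⟩

/-- Intervals of a locally finite lattice are locally finite. -/
theorem LocallyFiniteLattice.Icc (hL : LocallyFiniteLattice L) (hab : a < b) :
    @LocallyFiniteBoundedLattice (Set.Icc a b) _ (intervalBoundedOrder hab) := by
  let := intervalBoundedOrder hab
  intro s hs
  refine Set.Finite.of_finite_image ?_ Subtype.val_injective.injOn
  rw [image_latticeClosure _ Subtype.val (fun _ _ ↦ rfl) (fun _ _ ↦ rfl)]
  exact hL _ ((hs.union (Set.toFinite _)).image _)

theorem IsFraisseLimitFinLat.Icc (hL : IsFraisseLimitFinLat L) (hab : a < b) :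
    @IsFraisseLimitFinBddLat (Set.Icc a b) _ (intervalBoundedOrder hab) :=
  let := intervalBoundedOrder hab
  ⟨hL.isFraisse.Icc hab, hL.locallyFinite.Icc hab⟩

end Interval

/-- The class of finite `{0,1}`-lattices has a Fraïssé limit. -/
theorem exists_isFraisseLimitFinBddLat :
    ∃ (K : Type) (_ : Lattice K) (_ : BoundedOrder K), IsFraisseLimitFinBddLat K := by
  obtain ⟨L, _, hL⟩ := exists_isFraisseLimitFinLat
  obtain ⟨h, hh⟩ := hL.isFraisse.universal Bool
  have hlt : h ⊥ < h ⊤ := (OrderHomClass.mono h bot_le).lt_of_ne (hh.ne bot_ne_top)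
  exact ⟨Set.Icc (h ⊥) (h ⊤), _, intervalBoundedOrder hlt, hL.Icc hlt⟩

/-! ### Uniqueness by back and forth -/

theorem Finite.exists_lattice_orderIso (α : Type*) [Lattice α] [Finite α] :
    ∃ (β : Type) (_ : Lattice β) (_ : Finite β), Nonempty (β ≃o α) :=
  have ⟨L, e⟩ := (Finite.equivFin α).symm.exists_lattice_orderIso
  ⟨Fin (Nat.card α), L, inferInstance, e⟩

/-- The isomorphic copy of a bounded order carries a bounded order. -/
abbrev OrderIso.boundedOrder {α β : Type*} [Lattice α] [Lattice β] [BoundedOrder β] (e : α ≃o β) :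
    BoundedOrder α where
  top := e.symm ⊤
  le_top _ := e.le_symm_apply.2 le_top
  bot := e.symm ⊥
  bot_le _ := e.symm_apply_le.2 bot_le

/-- The extension property for finite `{0,1}`-lattices in arbitrary universes. -/
theorem IsFraisseStructureFinBddLat.exists_extension {K : Type*} [Lattice K] [BoundedOrder K]
    (hK : IsFraisseStructureFinBddLat K) {A B : Type*} [Lattice A] [BoundedOrder A] [Nontrivial A]
    [Finite A] [Lattice B] [BoundedOrder B] [Nontrivial B] [Finite B]
    (f : BoundedLatticeHom A B) (g : BoundedLatticeHom A K)
    (hf : Function.Injective f) (hg : Function.Injective g) :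
    ∃ h : BoundedLatticeHom B K, Function.Injective h ∧ ∀ x, h (f x) = g x := by
  obtain ⟨A', _, _, ⟨u⟩⟩ := Finite.exists_lattice_orderIso A
  obtain ⟨B', _, _, ⟨v⟩⟩ := Finite.exists_lattice_orderIso B
  let := u.boundedOrder
  let := v.boundedOrder
  have := u.toEquiv.nontrivial
  have := v.toEquiv.nontrivial
  obtain ⟨h, hh, hfg⟩ := hK.ultrahomogeneous A' B'
    ((v.symm : BoundedLatticeHom B B').comp (f.comp (u : BoundedLatticeHom A' A)))
    (g.comp (u : BoundedLatticeHom A' A)) (v.symm.injective.comp (hf.comp u.injective))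
    (hg.comp u.injective)
  refine ⟨h.comp (v.symm : BoundedLatticeHom B B'), hh.comp v.symm.injective, fun x ↦ ?_⟩
  simpa using hfg (u.symm x)

/-- A finite partial isomorphism between bounded lattices, given by its graph. -/
structure FinitePartialLatticeIso (α β : Type*) [Lattice α] [BoundedOrder α] [Lattice β]
    [BoundedOrder β] where
  /-- The graph of the partial isomorphism. -/
  graph : Set (α × β)
  finite : graph.Finite
  isSublattice : IsSublattice graph
  bot_mem : (⊥, ⊥) ∈ graph
  top_mem : (⊤, ⊤) ∈ graph
  injOn_fst : Set.InjOn Prod.fst graph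
  injOn_snd : Set.InjOn Prod.snd graph

namespace FinitePartialLatticeIso

variable {α β : Type*} [Lattice α] [BoundedOrder α] [Lattice β] [BoundedOrder β]

instance : Preorder (FinitePartialLatticeIso α β) :=
  Preorder.lift graph

/-- The inverse of a partial isomorphism. -/
def symm (p : FinitePartialLatticeIso α β) : FinitePartialLatticeIso β α where
  graph := Prod.swap ⁻¹' p.graph
  finite := p.finite.preimage Prod.swap_injective.injOn
  isSublattice := ⟨fun _ hx _ hy ↦ p.isSublattice.supClosed hx hy,
    fun _ hx _ hy ↦ p.isSublattice.infClosed hx hy⟩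
  bot_mem := p.bot_mem
  top_mem := p.top_mem
  injOn_fst _ hx _ hy h := Prod.swap_injective (p.injOn_snd hx hy h)
  injOn_snd _ hx _ hy h := Prod.swap_injective (p.injOn_fst hx hy h)

/-- The partial isomorphism matching the bounds. -/
def bounds (hα : (⊥ : α) ≠ ⊤) (hβ : (⊥ : β) ≠ ⊤) : FinitePartialLatticeIso α β where
  graph := {⊥, ⊤}
  finite := Set.toFinite _
  isSublattice := ⟨by rintro _ (rfl | rfl) _ (rfl | rfl) <;> simp,
    by rintro _ (rfl | rfl) _ (rfl | rfl) <;> simp⟩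
  bot_mem := Or.inl rfl
  top_mem := Or.inr rfl
  injOn_fst := by
    rintro _ (rfl | rfl) _ (rfl | rfl) h
    exacts [rfl, (hα h).elim, (hα h.symm).elim, rfl]
  injOn_snd := by
    rintro _ (rfl | rfl) _ (rfl | rfl) h
    exacts [rfl, (hβ h).elim, (hβ h.symm).elim, rfl]

/-- The order is recovered from joins, and the graph is closed under joins with each coordinate
determining the pair. -/
theorem fst_le_fst_iff (p : FinitePartialLatticeIso α β) {x y : α × β} (hx : x ∈ p.graph)
    (hy : y ∈ p.graph) : x.1 ≤ y.1 ↔ x.2 ≤ y.2 := by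
  have hxy := p.isSublattice.supClosed hx hy
  rw [← sup_eq_right, ← sup_eq_right]
  exact ⟨fun h ↦ congrArg Prod.snd (p.injOn_fst hxy hy h),
    fun h ↦ congrArg Prod.fst (p.injOn_snd hxy hy h)⟩

/-- A finite partial isomorphism to a Fraïssé structure can be extended to any further element. -/
theorem exists_le_mem_left (hα : LocallyFiniteBoundedLattice α)
    (hβ : IsFraisseStructureFinBddLat β) (hne : (⊥ : α) ≠ ⊤) (p : FinitePartialLatticeIso α β)
    (a : α) : ∃ q, p ≤ q ∧ ∃ b, (a, b) ∈ q.graph := by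
  let S : Set α := latticeClosure ((insert a (Prod.fst '' p.graph)) ∪ {⊥, ⊤})
  have hS : IsSublattice S := isSublattice_latticeClosure
  have hsub : (insert a (Prod.fst '' p.graph)) ∪ {⊥, ⊤} ⊆ S := subset_latticeClosure
  have hbot : ⊥ ∈ S := hsub (Or.inr (Or.inl rfl))
  have htop : ⊤ ∈ S := hsub (Or.inr (Or.inr rfl))
  have hp (x) (hx : x ∈ p.graph) : x.1 ∈ S := hsub (Or.inl (Or.inr ⟨x, hx, rfl⟩))
  -- The graph itself is the smaller lattice: its first projection embeds it in `B`, the sublattice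
  -- generated by adjoining `a`, and its second projection embeds it in `β`. The graph of the
  -- extension to `B` is the required `q`.
  let A : Sublattice (α × β) := ⟨p.graph, p.isSublattice.1, p.isSublattice.2⟩
  let B : Sublattice α := ⟨S, hS.1, hS.2⟩
  have : Finite A := p.finite
  have : Finite B := hα _ ((p.finite.image _).insert a)
  let : BoundedOrder A :=
    { bot := ⟨⊥, p.bot_mem⟩, top := ⟨⊤, p.top_mem⟩
      bot_le := fun x ↦ (bot_le : ⊥ ≤ x.1), le_top := fun x ↦ (le_top : x.1 ≤ ⊤) }
  let : BoundedOrder B :=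
    { bot := ⟨⊥, hbot⟩, top := ⟨⊤, htop⟩
      bot_le := fun x ↦ (bot_le : ⊥ ≤ x.1), le_top := fun x ↦ (le_top : x.1 ≤ ⊤) }
  have : Nontrivial A := ⟨⊥, ⊤, fun h ↦ hne (congrArg (fun x : A ↦ x.1.1) h)⟩
  have : Nontrivial B := ⟨⊥, ⊤, fun h ↦ hne (congrArg Subtype.val h)⟩
  let f : BoundedLatticeHom A B :=
    { toFun := fun x ↦ ⟨x.1.1, hp _ x.2⟩
      map_sup' := fun _ _ ↦ rfl
      map_inf' := fun _ _ ↦ rfl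
      map_top' := rfl
      map_bot' := rfl }
  let g : BoundedLatticeHom A β :=
    { toFun := fun x ↦ x.1.2
      map_sup' := fun _ _ ↦ rfl
      map_inf' := fun _ _ ↦ rfl
      map_top' := rfl
      map_bot' := rfl }
  obtain ⟨h, hh, hfg⟩ := hβ.exists_extension f g
    (fun x y hxy ↦ Subtype.ext (p.injOn_fst x.2 y.2 (congrArg Subtype.val hxy)))
    (fun x y hxy ↦ Subtype.ext (p.injOn_snd x.2 y.2 hxy))
  refine ⟨⟨Set.range fun x : B ↦ (x.1, h x), Set.finite_range _, ⟨?_, ?_⟩, ⟨⊥, ?_⟩, ⟨⊤, ?_⟩, ?_, ?_⟩,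
    ?_, h ⟨a, hsub (Or.inl (Or.inl rfl))⟩, ⟨⟨a, _⟩, rfl⟩⟩
  · rintro _ ⟨x, rfl⟩ _ ⟨y, rfl⟩
    exact ⟨x ⊔ y, Prod.ext rfl (map_sup h x y)⟩
  · rintro _ ⟨x, rfl⟩ _ ⟨y, rfl⟩
    exact ⟨x ⊓ y, Prod.ext rfl (map_inf h x y)⟩
  · exact Prod.ext rfl (map_bot h)
  · exact Prod.ext rfl (map_top h)
  · rintro _ ⟨x, rfl⟩ _ ⟨y, rfl⟩ hxy
    rw [Subtype.ext hxy]
  · rintro _ ⟨x, rfl⟩ _ ⟨y, rfl⟩ hxy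
    rw [hh hxy]
  · exact fun x hx ↦ ⟨f ⟨x, hx⟩, Prod.ext rfl (hfg ⟨x, hx⟩)⟩

end FinitePartialLatticeIso

open FinitePartialLatticeIso in
/-- Any two Fraïssé limits of the finite `{0,1}`-lattices are isomorphic. -/
theorem IsFraisseLimitFinBddLat.nonempty_orderIso {α β : Type*} [Lattice α] [BoundedOrder α]
    [Lattice β] [BoundedOrder β] (hα : IsFraisseLimitFinBddLat α)
    (hβ : IsFraisseLimitFinBddLat β) : Nonempty (α ≃o β) := by
  have hα' := hα.isFraisse.bot_ne_top
  have hβ' := hβ.isFraisse.bot_ne_top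
  have := hα.isFraisse.countable
  have := hβ.isFraisse.countable
  let := Encodable.ofCountable (α ⊕ β)
  -- One cofinal family for each element to be put in the domain or the range. There are countably
  -- many, so some ideal of partial isomorphisms meets them all; its union is the isomorphism.
  let D : α ⊕ β → Order.Cofinal (FinitePartialLatticeIso α β) := Sum.elim
    (fun a ↦ ⟨{p | ∃ b, (a, b) ∈ p.graph}, fun p ↦
      have ⟨q, hpq, hq⟩ := exists_le_mem_left hα.locallyFinite hβ.isFraisse hα' p a
      ⟨q, hq, hpq⟩⟩)
    (fun b ↦ ⟨{p | ∃ a, (a, b) ∈ p.graph}, fun p ↦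
      have ⟨q, hpq, hq⟩ := exists_le_mem_left hβ.locallyFinite hα.isFraisse hβ' p.symm b
      ⟨q.symm, hq, fun _ hx ↦ hpq hx⟩⟩)
  let I := Order.idealOfCofinals (bounds hα' hβ') D
  have hfst (a : α) : ∃ b, ∃ p ∈ I, (a, b) ∈ p.graph :=
    have ⟨p, ⟨b, hb⟩, hp⟩ := Order.cofinal_meets_idealOfCofinals (bounds hα' hβ') D (Sum.inl a)
    ⟨b, p, hp, hb⟩
  have hsnd (b : β) : ∃ a, ∃ p ∈ I, (a, b) ∈ p.graph :=
    have ⟨p, ⟨a, ha⟩, hp⟩ := Order.cofinal_meets_idealOfCofinals (bounds hα' hβ') D (Sum.inr b)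
    ⟨a, p, hp, ha⟩
  have hle {x y : α × β} : (∃ p ∈ I, x ∈ p.graph) → (∃ p ∈ I, y ∈ p.graph) →
      (x.1 ≤ y.1 ↔ x.2 ≤ y.2) := fun ⟨p, hp, hx⟩ ⟨q, hq, hy⟩ ↦
    have ⟨r, _, hpr, hqr⟩ := I.directed p hp q hq
    r.fst_le_fst_iff (hpr hx) (hqr hy)
  choose F hF using hfst
  choose G hG using hsnd
  have hGF (b : β) : F (G b) = b :=
    le_antisymm ((hle (hF (G b)) (hG b)).1 le_rfl) ((hle (hG b) (hF (G b))).1 le_rfl)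
  exact ⟨RelIso.ofSurjective (OrderEmbedding.ofMapLEIff F fun a a' ↦ (hle (hF a) (hF a')).symm)
    fun b ↦ ⟨G b, hGF b⟩⟩

/-! ### Intervals of the limit `K*` -/

/-- An order isomorphism restricts to intervals. -/
def OrderIso.restrictIcc {α β : Type*} [Preorder α] [Preorder β] (e : α ≃o β) (a b : α) :
    Set.Icc a b ≃o Set.Icc (e a) (e b) where
  toEquiv := e.toEquiv.subtypeEquiv fun x ↦ by simp [Set.mem_Icc]
  map_rel_iff' := e.le_iff_le

/-- An interval of an interval is an interval. -/
def Set.Icc.orderIsoIccVal {α : Type*} [Preorder α] {a b : α} (c d : Set.Icc a b) :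
    Set.Icc c d ≃o Set.Icc (c : α) (d : α) where
  toFun x := ⟨x.1.1, x.2⟩
  invFun x := ⟨⟨x.1, c.2.1.trans x.2.1, x.2.2.trans d.2.2⟩, x.2⟩
  left_inv _ := rfl
  right_inv _ := rfl
  map_rel_iff' := Iff.rfl

theorem mainTheorem5 :
    -- the two Fraïssé limits exist
    (∃ (L : Type) (_ : Lattice L), IsFraisseLimitFinLat L) ∧
    (∃ (K : Type) (_ : Lattice K) (_ : BoundedOrder K), IsFraisseLimitFinBddLat K) ∧
    -- whatever copy `L` of the first one is taken, its nontrivial intervals are as claimed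
    (∀ (L : Type*) [Lattice L], IsFraisseLimitFinLat L → ∀ (a b : L) (hab : a < b),
      @IsFraisseStructureFinBddLat (Set.Icc a b) _ (intervalBoundedOrder hab) ∧
      ∀ (K : Type*) [Lattice K] [BoundedOrder K], IsFraisseLimitFinBddLat K →
        Nonempty (Set.Icc a b ≃o K) ∧
        ∀ c d : K, c < d → Nonempty (Set.Icc a b ≃o Set.Icc c d)) := by
  refine ⟨exists_isFraisseLimitFinLat, exists_isFraisseLimitFinBddLat, fun L _ hL a b hab ↦
    ⟨hL.isFraisse.Icc hab, fun K _ _ hK ↦ ?_⟩⟩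
  let := intervalBoundedOrder hab
  obtain ⟨e⟩ := (hL.Icc hab).nonempty_orderIso hK
  refine ⟨⟨e⟩, fun c d hcd ↦ ?_⟩
  -- Pulled back along `e`, the interval `[c, d]` becomes an interval of `L`, hence again a limit of
  -- the finite `{0,1}`-lattices.
  have hlt : (e.symm c : L) < e.symm d := e.symm.strictMono hcd
  let := intervalBoundedOrder hlt
  obtain ⟨u⟩ := (hL.Icc hab).nonempty_orderIso (hL.Icc hlt)
  exact ⟨u.trans ((e.symm.restrictIcc c d).trans (Set.Icc.orderIsoIccVal _ _)).symm⟩
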